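/- **Definitions.** Nodes and pointers are natural numbers, with $\mathrm{null}=0$. A *binary graph* with contents in $T$ is a finite partial map $\gamma$ from non-null nodes to triples $(v,l,r)$, with $v\in T$ the contents of the node and $l,r$ its children ($\mathrm{null}$ if absent; a child need not be a node of $\gamma$). $\mathrm{nodes}\,\gamma$ is the domain of $\gamma$; $\gamma_1\bullet\gamma_2$ is the union of $\gamma_1$ and $\gamma_2$ if their domains are disjoint, and is undefined otherwise; $\gamma\setminus x$ is $\gamma$ made undefined on $x$; $\gamma/v$ is the restriction of $\gamma$ to the nodes with contents $v$; the erasure $|\gamma|$ forgets the contents of all nodes and keeps the children. $\gamma$ is *closed* if every child of a node of $\gamma$ is $\mathrm{null}$ or a node of $\gamma$. The set $\mathrm{reach}\,\gamma\,x$ is empty if $x\notin\mathrm{nodes}\,\gamma$, and if $\gamma\,x=(v,l,r)$ it is $\{x\}\cup\mathrm{reach}\,(\gamma\setminus x)\,l\cup\mathrm{reach}\,(\gamma\setminus x)\,r$. Marks are $O$ (unmarked), $L$, $R$, $X$ (fully traversed). For a binary graph $\gamma$ with contents in $\{O,L,R,X\}$, the assertion $\mathrm{graph}\,\gamma$ holds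 of a heap that consists exactly of pairwise disjoint blocks of three cells, one for each node $x$ with $\gamma\,x=(v,l,r)$: the cells $x$, $x+1$, $x+2$, storing $v$, $l$, $r$ and referred to as $x.m$, $x.l$, $x.r$. The program $\textit{Schorr-Waite}(r)$ is $t:=r;\ p:=\mathrm{null};\ \mathrm{READ};$ while $p\neq\mathrm{null}\vee\neg\, tm$ do (if $tm$ then ($pm:=p.m$; if $pm=R$ then POP else SWING) else PUSH); READ end while, where - READ: if $t=\mathrm{null}$ then $tm:=\mathrm{true}$ else ($tmp:=t.m$; $tm:=(tmp\neq O)$); - POP: $tmp:=p.r;\ p.r:=t;\ p.m:=X;\ t:=p;\ p:=tmp$; - SWING: $tmp_1:=p.r;\ tmp_2:=p.l;\ p.r:=tmp_2;\ p.l:=t;\ p.m:=R;\ t:=tmp_1$; - PUSH: $tmp:=t.l;\ t.l:=p;\ t.m:=L;\ p:=t;\ t:=tmp$. A Hoare triple $\{P\}\,C\,\{Q\}$ means that $C$, started in any state satisfying $P$, never faults (no access to null or to an unallocated cell, no type error), and that every final state it reaches satisfies $Q$. **Theorem.** For every binary graph $\gamma_0$ with contents in $\{O,L,R,X\}$ and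 every node $r$, $$\{\mathrm{graph}\,\gamma_0\wedge\mathrm{closed}\,\gamma_0\wedge r\in\mathrm{nodes}\,\gamma_0\wedge\gamma_0=\gamma_0/O\}$$ $$\textit{Schorr-Waite}(r)$$ $$\{\exists\gamma.\ \mathrm{graph}\,\gamma\wedge|\gamma_0|=|\gamma|\wedge\gamma=\gamma/X\bullet\gamma/O\wedge\mathrm{nodes}\,(\gamma/X)=\mathrm{reach}\,(\gamma_0/O)\,r\}.$$ Moreover, started in any state satisfying the precondition, $\textit{Schorr-Waite}(r)$ terminates. -/

import Mathlib

namespace GraphMarking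

/-- Finite partial maps on the natural numbers that are undefined on `null = 0`.
Both heaps (pointer to value) and graphs (node to contents and children) are such maps. -/
@[ext]
structure PMap (α : Type*) where
  lookup : ℕ → Option α
  finite_dom : {x | lookup x ≠ none}.Finite
  lookup_null : lookup 0 = none

namespace PMap

variable {α β : Type*}

/-- The domain of definition of a finite partial map. -/
def dom (f : PMap α) : Set ℕ := {x | f.lookup x ≠ none}

/-- The everywhere undefined map, which is the unit of `join`. -/
def empty : PMap α where
  lookup _ := none
  finite_dom := by simp
  lookup_null := rfl

/-- The map defined on the single argument `x`, with value `a`. -/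
def single (x : ℕ) (hx : x ≠ 0) (a : α) : PMap α where
  lookup y := if y = x then some a else none
  finite_dom := (Set.finite_singleton x).subset (by intro y; simp)
  lookup_null := if_neg hx.symm

/-- Union of partial maps (left-biased; only used on maps with disjoint domains). -/
def union (f g : PMap α) : PMap α where
  lookup x := (f.lookup x).or (g.lookup x)
  finite_dom := (f.finite_dom.union g.finite_dom).subset (by
    intro x hx
    by_contra hc
    simp only [Set.mem_union, Set.mem_ofPred_eq, not_or, not_not] at hc
    exact hx (by rw [hc.1, hc.2]; rfl))
  lookup_null := by rw [f.lookup_null, g.lookup_null]; rfl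

open Classical in
/-- Disjoint union: the partial operation that combines two maps with disjoint domains, and is
undefined (`none`) if the domains overlap. -/
noncomputable def join (f g : PMap α) : Option (PMap α) :=
  if Disjoint f.dom g.dom then some (f.union g) else none

open Classical in
/-- Restriction of a map to the arguments in `S`. -/
noncomputable def restrict (f : PMap α) (S : Set ℕ) : PMap α where
  lookup x := if x ∈ S then f.lookup x else none
  finite_dom := f.finite_dom.subset (by
    intro x hx h0
    exact hx (by simp [h0]))
  lookup_null := by simp [f.lookup_null]

/-- The map that agrees with `f` except that it is undefined on `x`. -/
noncomputable def remove (f : PMap α) (x : ℕ) : PMap α := f.restrict {x}ᶜ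

/-- Apply a function to every value of a map. -/
def map (u : α → β) (f : PMap α) : PMap β where
  lookup x := (f.lookup x).map u
  finite_dom := f.finite_dom.subset (by
    intro x hx h0
    exact hx (by simp [h0]))
  lookup_null := by simp [f.lookup_null]

/-- Overwrite the value of `f` at an argument `x` in the domain of `f`
(and leave `f` unchanged if `x` is not in its domain). -/
def update (f : PMap α) (x : ℕ) (a : α) : PMap α where
  lookup y := if y = x then (f.lookup x).map (fun _ => a) else f.lookup y
  finite_dom := f.finite_dom.subset (by
    intro y hy h0
    refine hy ?_
    split_ifs with h
    · subst h
      simp [h0]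
    · exact h0)
  lookup_null := by
    split_ifs with h
    · subst h
      simp [f.lookup_null]
    · exact f.lookup_null

theorem ncard_dom_remove_lt (f : PMap α) {x : ℕ} {a : α} (h : f.lookup x = some a) :
    (f.remove x).dom.ncard < f.dom.ncard := by
  refine Set.ncard_lt_ncard ⟨?_, ?_⟩ f.finite_dom
  · intro y hy h0
    exact hy (by simp [remove, restrict, h0])
  · intro hsub
    have hx : x ∈ f.dom := by simp [dom, h]
    exact hsub hx (by simp [remove, restrict])

end PMap

/-- Partial binary graphs with contents of type `T`: a node `x` of the graph is mapped to
`(v, l, r)`, where `v` is the contents of `x`, and `l` and `r` are its left and right child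
(`0`, i.e. null, if the child does not exist). A child need not be a node of the graph. -/
abbrev BinaryGraph (T : Type*) := PMap (T × ℕ × ℕ)

namespace BinaryGraph

variable {T : Type*}

/-- The set of nodes of the graph. -/
def nodes (γ : BinaryGraph T) : Set ℕ := PMap.dom γ

/-- The nodes of the graph together with null. -/
def nodes₀ (γ : BinaryGraph T) : Set ℕ := {0} ∪ nodes γ

/-- Filter by contents: the subgraph of the nodes whose contents lie in `V`. -/
noncomputable def filterVal (γ : BinaryGraph T) (V : Set T) : BinaryGraph T :=
  PMap.restrict γ {x | ∃ v l r, γ.lookup x = some (v, l, r) ∧ v ∈ V}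

/-- Erasure: forget the contents of all nodes, and keep the children. -/
def erasure (γ : BinaryGraph T) : BinaryGraph Unit :=
  PMap.map (fun a => ((), a.2)) γ

/-- The nodes that have an incoming edge (including null if some child does not exist). -/
def sinks (γ : BinaryGraph T) : Set ℕ :=
  {y | ∃ x v l r, γ.lookup x = some (v, l, r) ∧ (y = l ∨ y = r)}

/-- A graph is closed if it has no dangling edges. -/
def Closed (γ : BinaryGraph T) : Prop := sinks γ ⊆ nodes₀ γ

/-- The set of nodes of `γ` reachable from `x`: empty if `x` is not a node; otherwise `x`
together with the nodes reachable from the children of `x` in the graph without `x`. -/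
noncomputable def reach (γ : BinaryGraph T) (x : ℕ) : Set ℕ :=
  match _h : γ.lookup x with
  | none => ∅
  | some (_, l, r) => {x} ∪ (reach (PMap.remove γ x) l ∪ reach (PMap.remove γ x) r)
termination_by (PMap.dom γ).ncard
decreasing_by all_goals exact PMap.ncard_dom_remove_lt γ _h

end BinaryGraph

/-- The marks used during the traversal: `O` unmarked, `L` being traversed to the left, `R` being
traversed to the right, `X` completely traversed. -/
inductive Mark
  | O | L | R | X
  deriving DecidableEq

/-- Values of program variables and heap cells. The null pointer is `ptr 0`. -/
inductive Val
  | ptr (n : ℕ)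
  | mark (m : Mark)
  | bool (b : Bool)
  deriving DecidableEq

/-- Heaps: finite partial maps from non-null pointers to values. -/
abbrev Heap := PMap Val

/-- `pointsTo x vs` holds of the heap that contains exactly the pointers `x, x + 1, …`, storing
the values in the list `vs`. -/
def pointsTo (x : ℕ) (vs : List Val) (h : Heap) : Prop :=
  ∀ y, h.lookup y = if x ≤ y then vs[y - x]? else none

/-- `graph γ h`: the heap `h` is exactly a layout of the binary graph `γ`. The empty graph is laid
out as the empty heap, and the disjoint union of a node `x ↦ (v, l, r)` and a graph `γ` as the
disjoint union of three consecutive cells `x ⤇ v, l, r` and a layout of `γ`. -/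
inductive graph : BinaryGraph Mark → Heap → Prop
  | emp : graph PMap.empty PMap.empty
  | node {x : ℕ} (hx : x ≠ 0) {v : Mark} {l r : ℕ} {γ γ' : BinaryGraph Mark} {h₁ h₂ h : Heap} :
      PMap.join (PMap.single x hx (v, l, r)) γ = some γ' →
      PMap.join h₁ h₂ = some h →
      pointsTo x [Val.mark v, Val.ptr l, Val.ptr r] h₁ →
      graph γ h₂ →
      graph γ' h

/-! A small imperative language with a store of variables and a heap. -/

/-- Program variables. -/
inductive Var
  | t | p | tm | pm | tmp | tmp₁ | tmp₂
  deriving DecidableEq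

abbrev Store := Var → Val

/-- A program state. -/
structure State where
  store : Store
  heap : Heap

/-- Pure expressions. -/
inductive Expr
  | lit (v : Val)
  | var (x : Var)
  | eq (a b : Expr)
  | not (a : Expr)
  | or (a b : Expr)

/-- Value of an expression; `none` stands for a type error. -/
def Expr.eval (s : Store) : Expr → Option Val
  | lit v => some v
  | var x => some (s x)
  | eq a b =>
    match a.eval s, b.eval s with
    | some u, some v => some (Val.bool (decide (u = v)))
    | _, _ => none
  | not a =>
    match a.eval s with
    | some (Val.bool b) => some (Val.bool (!b))
    | _ => none
  | or a b =>
    match a.eval s, b.eval s with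
    | some (Val.bool u), some (Val.bool v) => some (Val.bool (u || v))
    | _, _ => none

/-- Commands: `load x e k` reads the cell at address `e + k` into the variable `x`, and
`write e k a` stores the value of `a` into the cell at address `e + k`. -/
inductive Cmd
  | skip
  | assign (x : Var) (a : Expr)
  | load (x : Var) (e : Expr) (k : ℕ)
  | write (e : Expr) (k : ℕ) (a : Expr)
  | seq (c d : Cmd)
  | ite (b : Expr) (c d : Cmd)
  | loop (b : Expr) (c : Cmd)

/-- Sequential composition of a list of commands. -/
def Cmd.block : List Cmd → Cmd
  | [] => Cmd.skip
  | [c] => c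
  | c :: cs => Cmd.seq c (Cmd.block cs)

/-- Assignment to a variable. -/
def State.set (σ : State) (x : Var) (v : Val) : State :=
  ⟨Function.update σ.store x v, σ.heap⟩

/-- The address denoted by `e + k`, provided that `e` is a non-null pointer and that the cell at
this address is allocated; `none` otherwise. -/
def State.addr (σ : State) (e : Expr) (k : ℕ) : Option ℕ :=
  match e.eval σ.store with
  | some (Val.ptr n) => if n ≠ 0 ∧ (σ.heap.lookup (n + k)).isSome then some (n + k) else none
  | _ => none

/-- Outcomes of a finished execution: a fault (access to null or to a cell that is not allocated,
or a type error), or a final state. -/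
inductive Outcome
  | fault
  | ok (σ : State)

/-- Big-step operational semantics. Diverging executions have no outcome. -/
inductive Exec : Cmd → State → Outcome → Prop
  | skip {σ : State} : Exec Cmd.skip σ (Outcome.ok σ)
  | assign {x : Var} {a : Expr} {σ : State} {v : Val} :
      a.eval σ.store = some v → Exec (Cmd.assign x a) σ (Outcome.ok (σ.set x v))
  | assign_fault {x : Var} {a : Expr} {σ : State} :
      a.eval σ.store = none → Exec (Cmd.assign x a) σ Outcome.fault
  | load {x : Var} {e : Expr} {k n : ℕ} {σ : State} {v : Val} :
      σ.addr e k = some n → σ.heap.lookup n = some v →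
      Exec (Cmd.load x e k) σ (Outcome.ok (σ.set x v))
  | load_fault {x : Var} {e : Expr} {k : ℕ} {σ : State} :
      σ.addr e k = none → Exec (Cmd.load x e k) σ Outcome.fault
  | write {e a : Expr} {k n : ℕ} {σ : State} {v : Val} :
      σ.addr e k = some n → a.eval σ.store = some v →
      Exec (Cmd.write e k a) σ (Outcome.ok ⟨σ.store, PMap.update σ.heap n v⟩)
  | write_fault {e a : Expr} {k : ℕ} {σ : State} :
      (σ.addr e k = none ∨ a.eval σ.store = none) → Exec (Cmd.write e k a) σ Outcome.fault
  | seq {c d : Cmd} {σ σ' : State} {o : Outcome} :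
      Exec c σ (Outcome.ok σ') → Exec d σ' o → Exec (Cmd.seq c d) σ o
  | seq_fault {c d : Cmd} {σ : State} :
      Exec c σ Outcome.fault → Exec (Cmd.seq c d) σ Outcome.fault
  | ite_true {b : Expr} {c d : Cmd} {σ : State} {o : Outcome} :
      b.eval σ.store = some (Val.bool true) → Exec c σ o → Exec (Cmd.ite b c d) σ o
  | ite_false {b : Expr} {c d : Cmd} {σ : State} {o : Outcome} :
      b.eval σ.store = some (Val.bool false) → Exec d σ o → Exec (Cmd.ite b c d) σ o
  | ite_fault {b : Expr} {c d : Cmd} {σ : State} :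
      (∀ u : Bool, b.eval σ.store ≠ some (Val.bool u)) → Exec (Cmd.ite b c d) σ Outcome.fault
  | loop_true {b : Expr} {c : Cmd} {σ : State} {o : Outcome} :
      b.eval σ.store = some (Val.bool true) → Exec (Cmd.seq c (Cmd.loop b c)) σ o →
      Exec (Cmd.loop b c) σ o
  | loop_false {b : Expr} {c : Cmd} {σ : State} :
      b.eval σ.store = some (Val.bool false) → Exec (Cmd.loop b c) σ (Outcome.ok σ)
  | loop_fault {b : Expr} {c : Cmd} {σ : State} :
      (∀ u : Bool, b.eval σ.store ≠ some (Val.bool u)) → Exec (Cmd.loop b c) σ Outcome.fault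

/-- The fault-avoiding Hoare triple of separation logic: started in a state satisfying `P`, the
command never faults, and whenever it terminates, the final state satisfies `Q`. -/
def Triple (P : State → Prop) (c : Cmd) (Q : State → Prop) : Prop :=
  ∀ σ, P σ → ∀ o, Exec c σ o → ∃ σ', o = Outcome.ok σ' ∧ Q σ'

/-- Started in a state satisfying `P`, the command terminates without a fault. -/
def Terminates (P : State → Prop) (c : Cmd) : Prop :=
  ∀ σ, P σ → ∃ σ', Exec c σ (Outcome.ok σ')

/-! The algorithm. The fields `m`, `l`, `r` of a node are at offsets `0`, `1`, `2`. -/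

def fieldM : ℕ := 0
def fieldL : ℕ := 1
def fieldR : ℕ := 2

def Expr.null : Expr := Expr.lit (Val.ptr 0)

/-- `if t = null then tm := true else tmp := t.m; tm := (tmp ≠ O) end if` -/
def readMark : Cmd :=
  Cmd.ite (Expr.eq (Expr.var Var.t) Expr.null)
    (Cmd.assign Var.tm (Expr.lit (Val.bool true)))
    (Cmd.block [
      Cmd.load Var.tmp (Expr.var Var.t) fieldM,
      Cmd.assign Var.tm (Expr.not (Expr.eq (Expr.var Var.tmp) (Expr.lit (Val.mark Mark.O))))])

/-- `tmp := p.r; p.r := t; p.m := X; t := p; p := tmp` -/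
def pop : Cmd :=
  Cmd.block [
    Cmd.load Var.tmp (Expr.var Var.p) fieldR,
    Cmd.write (Expr.var Var.p) fieldR (Expr.var Var.t),
    Cmd.write (Expr.var Var.p) fieldM (Expr.lit (Val.mark Mark.X)),
    Cmd.assign Var.t (Expr.var Var.p),
    Cmd.assign Var.p (Expr.var Var.tmp)]

/-- `tmp₁ := p.r; tmp₂ := p.l; p.r := tmp₂; p.l := t; p.m := R; t := tmp₁` -/
def swing : Cmd :=
  Cmd.block [
    Cmd.load Var.tmp₁ (Expr.var Var.p) fieldR,
    Cmd.load Var.tmp₂ (Expr.var Var.p) fieldL,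
    Cmd.write (Expr.var Var.p) fieldR (Expr.var Var.tmp₂),
    Cmd.write (Expr.var Var.p) fieldL (Expr.var Var.t),
    Cmd.write (Expr.var Var.p) fieldM (Expr.lit (Val.mark Mark.R)),
    Cmd.assign Var.t (Expr.var Var.tmp₁)]

/-- `tmp := t.l; t.l := p; t.m := L; p := t; t := tmp` -/
def push : Cmd :=
  Cmd.block [
    Cmd.load Var.tmp (Expr.var Var.t) fieldL,
    Cmd.write (Expr.var Var.t) fieldL (Expr.var Var.p),
    Cmd.write (Expr.var Var.t) fieldM (Expr.lit (Val.mark Mark.L)),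
    Cmd.assign Var.p (Expr.var Var.t),
    Cmd.assign Var.t (Expr.var Var.tmp)]

/-- The Schorr-Waite algorithm started at the root `r`. -/
def schorrWaite (r : ℕ) : Cmd :=
  Cmd.block [
    Cmd.assign Var.t (Expr.lit (Val.ptr r)),
    Cmd.assign Var.p Expr.null,
    readMark,
    Cmd.loop
      (Expr.or (Expr.not (Expr.eq (Expr.var Var.p) Expr.null)) (Expr.not (Expr.var Var.tm)))
      (Cmd.block [
        Cmd.ite (Expr.var Var.tm)
          (Cmd.block [
            Cmd.load Var.pm (Expr.var Var.p) fieldM,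
            Cmd.ite (Expr.eq (Expr.var Var.pm) (Expr.lit (Val.mark Mark.R))) pop swing])
          push,
        readMark])]

/-- Precondition: the heap is a layout of `γ₀`, and `γ₀` is closed, contains `r` and is fully
unmarked. -/
def swPre (γ₀ : BinaryGraph Mark) (r : ℕ) (σ : State) : Prop :=
  graph γ₀ σ.heap ∧ BinaryGraph.Closed γ₀ ∧ r ∈ BinaryGraph.nodes γ₀ ∧
    γ₀ = BinaryGraph.filterVal γ₀ {Mark.O}

/-- Postcondition: the heap is a layout of a graph `γ` with the same erasure as `γ₀`, which splits
into its `X`-marked and its unmarked part, and whose `X`-marked nodes are exactly those reachable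
from `r` in `γ₀`. -/
def swPost (γ₀ : BinaryGraph Mark) (r : ℕ) (σ : State) : Prop :=
  ∃ γ : BinaryGraph Mark, graph γ σ.heap ∧
    BinaryGraph.erasure γ₀ = BinaryGraph.erasure γ ∧
    PMap.join (BinaryGraph.filterVal γ {Mark.X}) (BinaryGraph.filterVal γ {Mark.O}) = some γ ∧
    BinaryGraph.nodes (BinaryGraph.filterVal γ {Mark.X}) =
      BinaryGraph.reach (BinaryGraph.filterVal γ₀ {Mark.O}) r

end GraphMarking

namespace GraphMarking

/-! ### Partial maps, described by their lookups. -/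

namespace PMap

variable {α β : Type*}

/-! No invariant about the stack of reversed pointers is needed. Despite the single loop, the
program behaves like a recursive depth-first search: when the loop head is entered with `t = x` and
`p = q`, it is entered again later with the same `t` and `p`, and with a graph that differs only in
that all nodes reachable from `x` through unmarked nodes carry the mark `X`
(`loopReaches_traverse`). This goes by induction on the number of unmarked nodes. If `x` is
unmarked, push removes it from the unmarked graph, which is exactly the removal in the recursion of
`reach`. The induction hypothesis covers the left child; the link fields of `x` survive because `x`
is no longer reachable, so swing finds the parent there. The right child is treated likewise in what
is still unmarked, and pop restores the last pointer. The second traversal avoids what the first has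
marked; by `reach_union_reach_restrict` the two together still visit the reachable set of both
children. Since marking leaves children alone, erasure is preserved at the end. `graph.block`
reduces each heap write to an update of the abstract graph. The semantics is deterministic, so one
successful run gives both safety with the postcondition and termination. -/

theorem join_eq_some_iff {f g k : PMap α} :
    join f g = some k ↔
      (∀ y, f.lookup y = none ∨ g.lookup y = none) ∧
        ∀ y, k.lookup y = (f.lookup y).or (g.lookup y) := by
  have hd : Disjoint f.dom g.dom ↔ ∀ y, f.lookup y = none ∨ g.lookup y = none := by
    rw [Set.disjoint_left]
    refine forall_congr' fun y => ?_
    simp only [dom, Set.mem_ofPred_eq, not_not]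
    tauto
  unfold join
  rw [← hd]
  split_ifs with h
  · simp only [h, true_and, Option.some.injEq]
    constructor
    · rintro rfl y
      rfl
    · intro hk
      ext1
      funext y
      exact (hk y).symm
  · simp [h]

theorem lookup_update (f : PMap α) (x y : ℕ) (a : α) :
    (f.update x a).lookup y = if y = x then (f.lookup x).map (fun _ => a) else f.lookup y := rfl

theorem lookup_update_self {f : PMap α} {x : ℕ} {b : α} (a : α) (h : f.lookup x = some b) :
    (f.update x a).lookup x = some a := by
  simp [lookup_update, h]

theorem lookup_single {x : ℕ} (hx : x ≠ 0) (a : α) (y : ℕ) :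
    (single x hx a).lookup y = if y = x then some a else none := rfl

open Classical in
theorem lookup_restrict (f : PMap α) (S : Set ℕ) (y : ℕ) :
    (f.restrict S).lookup y = if y ∈ S then f.lookup y else none := by
  unfold restrict
  congr

theorem lookup_remove (f : PMap α) (x y : ℕ) :
    (f.remove x).lookup y = if y = x then none else f.lookup y := by
  classical
  simp [remove, lookup_restrict, ite_not]

theorem lookup_map (u : α → β) (f : PMap α) (y : ℕ) :
    (f.map u).lookup y = (f.lookup y).map u := rfl

theorem ne_zero_of_lookup {f : PMap α} {x : ℕ} {a : α} (h : f.lookup x = some a) : x ≠ 0 := by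
  rintro rfl
  simp [f.lookup_null] at h

theorem mem_dom_iff {f : PMap α} {x : ℕ} : x ∈ f.dom ↔ f.lookup x ≠ none := Iff.rfl

end PMap

open PMap

/-! ### Layouts of graphs -/

/-- The three cells at `x` store the node contents `a`. -/
structure HasBlock (h : Heap) (x : ℕ) (a : Mark × ℕ × ℕ) : Prop where
  mark : h.lookup x = some (Val.mark a.1)
  left : h.lookup (x + 1) = some (Val.ptr a.2.1)
  right : h.lookup (x + 2) = some (Val.ptr a.2.2)

theorem pointsTo_iff {x : ℕ} {v : Mark} {l r : ℕ} {h : Heap} :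
    pointsTo x [Val.mark v, Val.ptr l, Val.ptr r] h ↔
      HasBlock h x (v, l, r) ∧ ∀ y, (y < x ∨ x + 2 < y) → h.lookup y = none := by
  constructor
  · intro hp
    refine ⟨⟨?_, ?_, ?_⟩, ?_⟩
    · simpa using hp x
    · simpa using hp (x + 1)
    · simpa using hp (x + 2)
    · intro y hy
      rw [hp y]
      split_ifs with hxy
      · rw [List.getElem?_eq_none]
        simp only [List.length_cons, List.length_nil]
        omega
      · rfl
  · rintro ⟨⟨h0, h1, h2⟩, h3⟩ y
    split_ifs with hxy
    · obtain ⟨k, rfl⟩ := Nat.exists_eq_add_of_le hxy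
      rw [Nat.add_sub_cancel_left]
      match k with
      | 0 => simpa using h0
      | 1 => simpa using h1
      | 2 => simpa using h2
      | k + 3 => simpa using h3 (x + (k + 3)) (by omega)
    · exact h3 y (by omega)

/-- A layout of `γ` has the block of each node `x`, and overwriting this block yields a layout of
the graph with the contents of `x` overwritten. -/
theorem graph.block {γ : BinaryGraph Mark} {h : Heap} (hg : graph γ h) {x : ℕ}
    {a : Mark × ℕ × ℕ} (hx : γ.lookup x = some a) :
    HasBlock h x a ∧ ∀ (b : Mark × ℕ × ℕ) (h' : Heap),
      (∀ y, (y < x ∨ x + 2 < y) → h'.lookup y = h.lookup y) → HasBlock h' x b →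
        graph (γ.update x b) h' := by
  classical
  induction hg with
  | emp => simp [PMap.empty] at hx
  | @node z hz v l r γ γ' h₁ h₂ h hγ hh hp hg ih =>
    rw [join_eq_some_iff] at hγ hh
    obtain ⟨hγd, hγu⟩ := hγ
    obtain ⟨hhd, hhu⟩ := hh
    have hp' := pointsTo_iff.1 hp
    obtain ⟨⟨p0, p1, p2⟩, p3⟩ := hp'
    by_cases hxz : x = z
    · subst hxz
      have hγx : γ.lookup x = none := by simpa [lookup_single] using hγd x
      have ha : a = (v, l, r) := by
        have := hγu x
        rw [hx] at this
        simpa [lookup_single] using this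
      subst ha
      refine ⟨⟨by simp [hhu, p0], by simp [hhu, p1], by simp [hhu, p2]⟩, ?_⟩
      rintro ⟨v', l', r'⟩ h' ho hb
      -- The overwritten block is the one on top of the derivation, so the layout `h₂` of the other
      -- nodes is reused unchanged.
      refine graph.node (h₁ := h'.restrict {y | x ≤ y ∧ y ≤ x + 2}) (h₂ := h₂) hz
        (v := v') (l := l') (r := r') (join_eq_some_iff.2 ⟨?_, ?_⟩)
        (join_eq_some_iff.2 ⟨?_, ?_⟩) (pointsTo_iff.2 ⟨⟨?_, ?_, ?_⟩, ?_⟩) hg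
      · intro y
        rcases eq_or_ne y x with rfl | hy
        · exact Or.inr hγx
        · simp [lookup_single, hy]
      · intro y
        rcases eq_or_ne y x with rfl | hy
        · simp [lookup_single, lookup_update, hx]
        · simp [lookup_single, lookup_update, hy, hγu]
      · intro y
        rw [lookup_restrict]
        split_ifs with hy
        · right
          refine (hhd y).resolve_left ?_
          obtain ⟨hy1, hy2⟩ := hy
          have : y = x ∨ y = x + 1 ∨ y = x + 2 := by omega
          rcases this with rfl | rfl | rfl <;> simp_all
        · exact Or.inl rfl
      · intro y
        rw [lookup_restrict]
        split_ifs with hy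
        · obtain ⟨hy1, hy2⟩ := hy
          have : y = x ∨ y = x + 1 ∨ y = x + 2 := by omega
          rcases this with rfl | rfl | rfl
          · simp [hb.mark]
          · simp [hb.left]
          · simp [hb.right]
        · have hy' : y < x ∨ x + 2 < y := by
            simp only [Set.mem_ofPred_eq] at hy
            omega
          simp [ho y hy', hhu y, p3 y hy']
      · simp [lookup_restrict, hb.mark]
      · simp [lookup_restrict, hb.left]
      · simp [lookup_restrict, hb.right]
      · intro y hy
        rw [lookup_restrict, if_neg]
        simp only [Set.mem_ofPred_eq]
        omega
    · have hγx : γ.lookup x = some a := by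
        have := hγu x
        rw [hx] at this
        simpa [lookup_single, hxz] using this.symm
      obtain ⟨⟨b0, b1, b2⟩, ih'⟩ := ih hγx
      have n0 : h₁.lookup x = none := (hhd x).resolve_right (by simp [b0])
      have n1 : h₁.lookup (x + 1) = none := (hhd _).resolve_right (by simp [b1])
      have n2 : h₁.lookup (x + 2) = none := (hhd _).resolve_right (by simp [b2])
      refine ⟨⟨by simp [hhu, n0, b0], by simp [hhu, n1, b1], by simp [hhu, n2, b2]⟩, ?_⟩
      intro b h' ho hb
      -- The block of `x` lies in `h₂` and, by `n0`, `n1`, `n2`, misses `h₁`. Hence `h'` agrees with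
      -- `h₁` on the domain of `h₁`, and the remainder of `h'` is the new layout of the other nodes.
      refine graph.node (h₁ := h₁) (h₂ := h'.restrict {y | h₁.lookup y = none}) hz
        (γ := γ.update x b) (join_eq_some_iff.2 ⟨?_, ?_⟩)
        (join_eq_some_iff.2 ⟨?_, ?_⟩) hp (ih' b _ ?_ ⟨?_, ?_, ?_⟩)
      · intro y
        rcases eq_or_ne y x with rfl | hy
        · simp [lookup_single, hxz]
        · simpa [lookup_update, hy] using hγd y
      · intro y
        rcases eq_or_ne y x with rfl | hy
        · simp [lookup_single, lookup_update, hxz, hx, hγx]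
        · simp [lookup_update, hy, hγu]
      · intro y
        rw [lookup_restrict]
        by_cases hy : h₁.lookup y = none <;> simp [hy]
      · intro y
        rw [lookup_restrict]
        split_ifs with hy
        · simp only [Set.mem_ofPred_eq] at hy
          simp [hy]
        · have hy' : y < x ∨ x + 2 < y := by
            by_contra hc
            have : y = x ∨ y = x + 1 ∨ y = x + 2 := by omega
            rcases this with rfl | rfl | rfl
            · exact hy n0
            · exact hy n1
            · exact hy n2
          simp only [Set.mem_ofPred_eq] at hy
          rw [ho y hy', hhu y, (hhd y).resolve_left hy]
      · intro y hy
        rw [lookup_restrict]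
        split_ifs with hy1
        · simp only [Set.mem_ofPred_eq] at hy1
          simp [ho y hy, hhu y, hy1]
        · exact ((hhd y).resolve_left hy1).symm
      · simp [lookup_restrict, n0, hb.mark]
      · simp [lookup_restrict, n1, hb.left]
      · simp [lookup_restrict, n2, hb.right]

/-! ### Reachability -/

namespace BinaryGraph

variable {T : Type*}

/-- There is an edge from `a` to the node `b`. -/
def Edge (γ : BinaryGraph T) (a b : ℕ) : Prop :=
  ∃ v l r, γ.lookup a = some (v, l, r) ∧ (b = l ∨ b = r) ∧ b ∈ nodes γ

theorem reach_of_none {γ : BinaryGraph T} {x : ℕ} (h : γ.lookup x = none) : reach γ x = ∅ := by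
  rw [reach]
  split <;> simp_all

theorem reach_of_some {γ : BinaryGraph T} {x : ℕ} {v : T} {l r : ℕ}
    (h : γ.lookup x = some (v, l, r)) :
    reach γ x = {x} ∪ (reach (γ.remove x) l ∪ reach (γ.remove x) r) := by
  rw [reach]
  split <;> simp_all

theorem Edge.mono {γ δ : BinaryGraph T} (h : ∀ x a, γ.lookup x = some a → δ.lookup x = some a)
    {a b : ℕ} (he : Edge γ a b) : Edge δ a b := by
  obtain ⟨v, l, r, h1, h2, h3⟩ := he
  obtain ⟨c, hc⟩ := Option.ne_none_iff_exists'.1 h3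
  exact ⟨v, l, r, h _ _ h1, h2, by simp [nodes, PMap.dom, h _ _ hc]⟩

/-- Deleting visited nodes loses nothing: a path from `x` may be cut at its last visit to `x`, and
what follows starts at a child and avoids `x`. The condition `x ∈ nodes γ` is needed because the
reflexive closure relates every number to itself. -/
theorem mem_reach_iff {γ : BinaryGraph T} {x y : ℕ} :
    y ∈ reach γ x ↔ x ∈ nodes γ ∧ Relation.ReflTransGen (Edge γ) x y := by
  induction hn : (PMap.dom γ).ncard using Nat.strong_induction_on generalizing γ x y with
  | _ n ih =>
  cases hx : γ.lookup x with
  | none => simp [reach_of_none hx, nodes, PMap.dom, hx]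
  | some a =>
    obtain ⟨v, l, r⟩ := a
    have hlt := PMap.ncard_dom_remove_lt γ hx
    rw [hn] at hlt
    rw [reach_of_some hx]
    simp only [Set.mem_union, Set.mem_singleton_iff, ih _ hlt rfl]
    have hmono : ∀ z a, (γ.remove x).lookup z = some a → γ.lookup z = some a := by
      intro z a hz
      rw [lookup_remove] at hz
      split_ifs at hz
      exact hz
    have hsub : nodes (γ.remove x) ⊆ nodes γ := by
      intro z hz h0
      exact hz (by simp [lookup_remove, h0])
    have hxn : x ∈ nodes γ := by simp [nodes, PMap.dom, hx]
    refine ⟨?_, ?_⟩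
    · rintro (rfl | ⟨hl, hly⟩ | ⟨hr, hry⟩)
      · exact ⟨hxn, .refl⟩
      · exact ⟨hxn, .head ⟨v, l, r, hx, Or.inl rfl, hsub hl⟩
          (Relation.ReflTransGen.mono (fun _ _ => Edge.mono hmono) _ _ hly)⟩
      · exact ⟨hxn, .head ⟨v, l, r, hx, Or.inr rfl, hsub hr⟩
          (Relation.ReflTransGen.mono (fun _ _ => Edge.mono hmono) _ _ hry)⟩
    · rintro ⟨-, hxy⟩
      induction hxy with
      | refl => exact Or.inl rfl
      | @tail b c _ hbc ih2 =>
        by_cases hc : c = x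
        · exact Or.inl hc
        have hcn : c ∈ nodes γ := hbc.choose_spec.choose_spec.choose_spec.2.2
        have hcn' : c ∈ nodes (γ.remove x) := by
          simpa [nodes, PMap.dom, lookup_remove, hc] using hcn
        -- An edge leaving `x` discards the path so far and restarts it at a child; any other edge
        -- survives in the graph without `x`.
        by_cases hb : b = x
        · subst hb
          obtain ⟨v', l', r', h1, h2, h3⟩ := hbc
          rw [hx] at h1
          cases h1
          rcases h2 with rfl | rfl
          · exact Or.inr (Or.inl ⟨hcn', .refl⟩)
          · exact Or.inr (Or.inr ⟨hcn', .refl⟩)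
        have hbc' : Edge (γ.remove x) b c := by
          obtain ⟨v', l', r', h1, h2, h3⟩ := hbc
          exact ⟨v', l', r', by simp [lookup_remove, hb, h1], h2, hcn'⟩
        rcases ih2 with h | ⟨hl, h⟩ | ⟨hr, h⟩
        · exact absurd h hb
        · exact Or.inr (Or.inl ⟨hl, h.tail hbc'⟩)
        · exact Or.inr (Or.inr ⟨hr, h.tail hbc'⟩)

theorem reach_subset_nodes (γ : BinaryGraph T) (x : ℕ) : reach γ x ⊆ nodes γ := by
  intro y hy
  obtain ⟨hx, hxy⟩ := mem_reach_iff.1 hy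
  rcases hxy.cases_tail with rfl | ⟨b, -, v, l, r, -, -, h⟩
  · exact hx
  · exact h

/-- After the nodes reachable from `l`, a traversal from `r` only has to visit the nodes that are
reachable without them. -/
theorem reach_union_reach_restrict (γ : BinaryGraph T) (l r : ℕ) :
    reach γ l ∪ reach (γ.restrict (reach γ l)ᶜ) r = reach γ l ∪ reach γ r := by
  classical
  have hmono : ∀ z a, (γ.restrict (reach γ l)ᶜ).lookup z = some a → γ.lookup z = some a := by
    intro z a hz
    rw [lookup_restrict] at hz
    split_ifs at hz
    exact hz
  ext y
  simp only [Set.mem_union]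
  by_cases hy : y ∈ reach γ l
  · simp [hy]
  simp only [hy, false_or]
  rw [mem_reach_iff, mem_reach_iff]
  constructor
  · rintro ⟨hr, h⟩
    obtain ⟨a, ha⟩ := Option.ne_none_iff_exists'.1 hr
    exact ⟨by simp [nodes, PMap.dom, hmono _ _ ha],
      Relation.ReflTransGen.mono (fun _ _ => Edge.mono hmono) _ _ h⟩
  · rintro ⟨hr, h⟩
    induction h with
    | refl => exact ⟨by simpa [nodes, PMap.dom, lookup_restrict, hy] using hr, .refl⟩
    | @tail b c _ hbc ih =>
      -- `reach γ l` is closed under edges, so every predecessor of a node outside it is outside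
      -- too.
      have hb : b ∉ reach γ l := by
        intro hb
        rw [mem_reach_iff] at hb hy
        exact hy ⟨hb.1, hb.2.tail hbc⟩
      obtain ⟨h1, h2⟩ := ih hb
      refine ⟨h1, h2.tail ?_⟩
      obtain ⟨v, l', r', h3, h4, h5⟩ := hbc
      exact ⟨v, l', r', by simp [lookup_restrict, hb, h3], h4,
        by simpa [nodes, PMap.dom, lookup_restrict, hy] using h5⟩

end BinaryGraph

/-! ### Execution -/

/-- The rules for each command have mutually exclusive premises. -/
theorem Exec.deterministic {c : Cmd} {σ : State} {o o' : Outcome} (h : Exec c σ o)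
    (h' : Exec c σ o') : o = o' := by
  induction h generalizing o' with
  | skip => cases h'; rfl
  | assign | assign_fault => cases h' <;> simp_all
  | load | load_fault => cases h' <;> simp_all
  | write => cases h' <;> simp_all
  | write_fault hf =>
    cases h' with
    | write h1 h2 => simp_all
    | write_fault => rfl
  | seq _ _ ih1 ih2 =>
    cases h' with
    | seq h1 h2 =>
      cases ih1 h1
      exact ih2 h2
    | seq_fault h1 => cases ih1 h1
  | seq_fault _ ih =>
    cases h' with
    | seq h1 h2 => cases ih h1
    | seq_fault => rfl
  | ite_true hb _ ih | ite_false hb _ ih | loop_true hb _ ih =>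
    cases h' <;> first | (apply ih; assumption) | simp_all
  | ite_fault | loop_false | loop_fault => cases h' <;> simp_all

theorem triple_and_terminates {P Q : State → Prop} {c : Cmd}
    (h : ∀ σ, P σ → ∃ σ', Exec c σ (Outcome.ok σ') ∧ Q σ') : Triple P c Q ∧ Terminates P c := by
  refine ⟨fun σ hσ o ho => ?_, fun σ hσ => ?_⟩
  · obtain ⟨σ', h1, h2⟩ := h σ hσ
    exact ⟨σ', ho.deterministic h1, h2⟩
  · obtain ⟨σ', h1, -⟩ := h σ hσ
    exact ⟨σ', h1⟩

/-! ### Filtering, updating and marking graphs. -/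

namespace BinaryGraph

variable {T : Type*}

theorem lookup_filterVal {γ : BinaryGraph T} {V : Set T} {y : ℕ} {a : T × ℕ × ℕ} :
    (γ.filterVal V).lookup y = some a ↔ γ.lookup y = some a ∧ a.1 ∈ V := by
  classical
  obtain ⟨v, l, r⟩ := a
  rw [filterVal, lookup_restrict]
  split_ifs with h
  · obtain ⟨v', l', r', h1, h2⟩ := h
    rw [h1]
    constructor
    · intro h
      cases h
      exact ⟨rfl, h2⟩
    · exact fun h => h.1
  · simp only [false_iff]
    exact fun h' => h ⟨v, l, r, h'⟩

theorem mem_nodes_iff {γ : BinaryGraph T} {y : ℕ} : y ∈ nodes γ ↔ ∃ a, γ.lookup y = some a :=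
  Option.ne_none_iff_exists'

theorem mem_nodes_filterVal {γ : BinaryGraph T} {V : Set T} {y : ℕ} :
    y ∈ nodes (γ.filterVal V) ↔ ∃ a, γ.lookup y = some a ∧ a.1 ∈ V := by
  simp only [mem_nodes_iff, lookup_filterVal]

theorem nodes_update (γ : BinaryGraph T) (x : ℕ) (a : T × ℕ × ℕ) :
    nodes (γ.update x a) = nodes γ := by
  ext y
  simp only [nodes, mem_dom_iff, lookup_update]
  split_ifs with h
  · simp [h]
  · rfl

theorem nodes₀_update (γ : BinaryGraph T) (x : ℕ) (a : T × ℕ × ℕ) :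
    nodes₀ (γ.update x a) = nodes₀ γ := by
  rw [nodes₀, nodes_update, nodes₀]

open Classical in
/-- Mark all nodes in `S` as completely traversed. -/
noncomputable def markX (γ : BinaryGraph Mark) (S : Set ℕ) : BinaryGraph Mark where
  lookup y := (γ.lookup y).map fun a => if y ∈ S then (Mark.X, a.2) else a
  finite_dom := γ.finite_dom.subset (by
    intro x hx h0
    exact hx (by simp [h0]))
  lookup_null := by simp [γ.lookup_null]

theorem lookup_markX_of_mem {γ : BinaryGraph Mark} {S : Set ℕ} {y : ℕ} (h : y ∈ S) :
    (γ.markX S).lookup y = (γ.lookup y).map fun a => (Mark.X, a.2) := by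
  simp [markX, h]

theorem lookup_markX_of_notMem {γ : BinaryGraph Mark} {S : Set ℕ} {y : ℕ} (h : y ∉ S) :
    (γ.markX S).lookup y = γ.lookup y := by
  simp [markX, h]

theorem nodes_markX (γ : BinaryGraph Mark) (S : Set ℕ) : nodes (γ.markX S) = nodes γ := by
  ext y
  simp [nodes, mem_dom_iff, markX]

theorem nodes₀_markX (γ : BinaryGraph Mark) (S : Set ℕ) : nodes₀ (γ.markX S) = nodes₀ γ := by
  rw [nodes₀, nodes_markX, nodes₀]

theorem markX_empty (γ : BinaryGraph Mark) : γ.markX ∅ = γ := by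
  ext1
  funext y
  exact lookup_markX_of_notMem (Set.notMem_empty y)

/-- The subgraph of the unmarked nodes. -/
noncomputable abbrev unmarked (γ : BinaryGraph Mark) : BinaryGraph Mark :=
  γ.filterVal {Mark.O}

/-- Seen from the unmarked graph, push is a deletion; this matches the program with the recursion of
`reach`. -/
theorem unmarked_update {γ : BinaryGraph Mark} {x : ℕ} {a : Mark × ℕ × ℕ} (ha : a.1 ≠ Mark.O) :
    unmarked (γ.update x a) = (unmarked γ).remove x := by
  ext1
  funext y
  refine Option.ext fun b => ?_
  rw [lookup_filterVal, lookup_update, lookup_remove]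
  split_ifs with h
  · simp only [Option.map_eq_some_iff, Set.mem_singleton_iff, iff_false, not_and]
    rintro ⟨c, -, rfl⟩
    exact ha
  · rw [lookup_filterVal]

theorem unmarked_markX (γ : BinaryGraph Mark) (S : Set ℕ) :
    unmarked (γ.markX S) = (unmarked γ).restrict Sᶜ := by
  classical
  ext1
  funext y
  refine Option.ext fun b => ?_
  rw [lookup_filterVal, lookup_restrict]
  by_cases h : y ∈ S
  · rw [lookup_markX_of_mem h]
    simp only [Set.mem_compl_iff, h, not_true, if_false, Option.map_eq_some_iff,
      Set.mem_singleton_iff, reduceCtorEq, iff_false, not_and]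
    rintro ⟨c, -, rfl⟩
    simp
  · simp [lookup_markX_of_notMem h, h, lookup_filterVal]

end BinaryGraph

/-! ### Execution of the program fragments. -/

open BinaryGraph

/-- The main loop of the algorithm. -/
def swLoop : Cmd :=
  Cmd.loop
    (Expr.or (Expr.not (Expr.eq (Expr.var Var.p) Expr.null)) (Expr.not (Expr.var Var.tm)))
    (Cmd.block [
      Cmd.ite (Expr.var Var.tm)
        (Cmd.block [
          Cmd.load Var.pm (Expr.var Var.p) fieldM,
          Cmd.ite (Expr.eq (Expr.var Var.pm) (Expr.lit (Val.mark Mark.R))) pop swing])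
        push,
      readMark])

/-- The heap is a layout of `γ`, and the variables `t` and `p` have the values `x` and `q`. -/
structure Holds (γ : BinaryGraph Mark) (x q : ℕ) (σ : State) : Prop where
  graph : graph γ σ.heap
  t : σ.store Var.t = Val.ptr x
  p : σ.store Var.p = Val.ptr q

/-- The state at the head of the main loop: the variable `tm` tells whether `t` is unmarked. -/
structure AtHead (γ : BinaryGraph Mark) (x q : ℕ) (σ : State) : Prop extends Holds γ x q σ where
  tm_true : x ∉ nodes (unmarked γ) → σ.store Var.tm = Val.bool true
  tm_false : x ∈ nodes (unmarked γ) → σ.store Var.tm = Val.bool false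

/-- The hypothesis `hx` is where closedness enters: reading the mark of `t` is safe only if `t` is
null or a node. -/
theorem exec_readMark {γ : BinaryGraph Mark} {x q : ℕ} {σ : State} (h : Holds γ x q σ)
    (hx : x ∈ nodes₀ γ) : ∃ σ', Exec readMark σ (Outcome.ok σ') ∧ AtHead γ x q σ' := by
  obtain ⟨hg, ht, hp⟩ := h
  simp only [readMark, Cmd.block]
  by_cases h0 : x = 0
  · subst h0
    have hn : 0 ∉ nodes (unmarked γ) := fun h => h (unmarked γ).lookup_null
    refine ⟨_, .ite_true ?_ (.assign rfl), ⟨⟨hg, ?_, ?_⟩, ?_, ?_⟩⟩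
    · simp [Expr.eval, Expr.null, ht]
    · simp [State.set, ht]
    · simp [State.set, hp]
    · simp [State.set]
    · exact fun h => absurd h hn
  · have hx' : x ∈ nodes γ := hx.resolve_left h0
    obtain ⟨⟨v, l, r⟩, ha⟩ := mem_nodes_iff.1 hx'
    obtain ⟨hb, -⟩ := hg.block ha
    refine ⟨_, .ite_false ?_ (.seq (.load (n := x) (v := Val.mark v) ?_ hb.mark)
      (.assign (v := Val.bool (decide (v ≠ Mark.O))) ?_)), ⟨⟨hg, ?_, ?_⟩, ?_, ?_⟩⟩
    · simp [Expr.eval, Expr.null, ht, h0]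
    · simp [State.addr, Expr.eval, ht, h0, fieldM, hb.mark]
    · simp [Expr.eval, State.set]
    · simp [State.set, ht]
    · simp [State.set, hp]
    · simp [State.set, mem_nodes_filterVal, ha]
    · simp [State.set, mem_nodes_filterVal, ha]

theorem exec_push {γ : BinaryGraph Mark} {x q l r : ℕ} {v : Mark} {σ : State}
    (h : Holds γ x q σ) (hx : γ.lookup x = some (v, l, r)) :
    ∃ σ', Exec push σ (Outcome.ok σ') ∧ Holds (γ.update x (Mark.L, q, r)) l x σ' := by
  obtain ⟨hg, ht, hp⟩ := h
  have h0 := ne_zero_of_lookup hx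
  obtain ⟨⟨b0, b1, b2⟩, hu⟩ := hg.block hx
  simp only [push, Cmd.block]
  refine ⟨_, .seq (.load (n := x + 1) (v := Val.ptr l) ?_ b1)
    (.seq (.write (n := x + 1) (v := Val.ptr q) ?_ ?_)
    (.seq (.write (n := x) (v := Val.mark Mark.L) ?_ rfl)
    (.seq (.assign (v := Val.ptr x) ?_) (.assign (v := Val.ptr l) ?_)))),
    ⟨hu _ _ ?_ ⟨?_, ?_, ?_⟩, ?_, ?_⟩⟩
  · simp [State.addr, Expr.eval, ht, h0, fieldL, b1]
  · simp [State.addr, Expr.eval, State.set, ht, h0, fieldL, b1]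
  · simp [Expr.eval, State.set, hp]
  · simp [State.addr, Expr.eval, State.set, ht, h0, fieldM, b0, lookup_update]
  · simp [Expr.eval, State.set, ht]
  · simp [Expr.eval, State.set]
  · intro y hy
    have h1 : y ≠ x := by omega
    have h2 : y ≠ x + 1 := by omega
    simp [State.set, lookup_update, h1, h2]
  · simp [State.set, lookup_update, b0]
  · simp [State.set, lookup_update, b1]
  · simp [State.set, lookup_update, b2]
  · simp [State.set]
  · simp [State.set]

/-- The left field holds the parent `q`, while the left child `l` is kept in `t`. A rotation of
three pointers puts `l` back, moves `q` to the right field and `r` to `t`. -/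
theorem exec_swing {γ : BinaryGraph Mark} {x q l r : ℕ} {v : Mark} {σ : State}
    (h : Holds γ l x σ) (hx : γ.lookup x = some (v, q, r)) :
    ∃ σ', Exec swing σ (Outcome.ok σ') ∧ Holds (γ.update x (Mark.R, l, q)) r x σ' := by
  obtain ⟨hg, ht, hp⟩ := h
  have h0 := ne_zero_of_lookup hx
  obtain ⟨⟨b0, b1, b2⟩, hu⟩ := hg.block hx
  simp only [swing, Cmd.block]
  refine ⟨_, .seq (.load (n := x + 2) (v := Val.ptr r) ?_ b2)
    (.seq (.load (n := x + 1) (v := Val.ptr q) ?_ b1)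
    (.seq (.write (n := x + 2) (v := Val.ptr q) ?_ ?_)
    (.seq (.write (n := x + 1) (v := Val.ptr l) ?_ ?_)
    (.seq (.write (n := x) (v := Val.mark Mark.R) ?_ rfl)
    (.assign (v := Val.ptr r) ?_))))),
    ⟨hu _ _ ?_ ⟨?_, ?_, ?_⟩, ?_, ?_⟩⟩
  · simp [State.addr, Expr.eval, hp, h0, fieldR, b2]
  · simp [State.addr, Expr.eval, State.set, hp, h0, fieldL, b1]
  · simp [State.addr, Expr.eval, State.set, hp, h0, fieldR, b2]
  · simp [Expr.eval, State.set]
  · simp [State.addr, Expr.eval, State.set, hp, h0, fieldL, b1, lookup_update]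
  · simp [Expr.eval, State.set, ht]
  · simp [State.addr, Expr.eval, State.set, hp, h0, fieldM, b0, lookup_update]
  · simp [Expr.eval, State.set]
  · intro y hy
    have h1 : y ≠ x := by omega
    have h2 : y ≠ x + 1 := by omega
    have h3 : y ≠ x + 2 := by omega
    simp [State.set, lookup_update, h1, h2, h3]
  · simp [State.set, lookup_update, b0]
  · simp [State.set, lookup_update, b1]
  · simp [State.set, lookup_update, b2]
  · simp [State.set]
  · simp [State.set, hp]

theorem exec_pop {γ : BinaryGraph Mark} {x q l r : ℕ} {v : Mark} {σ : State}
    (h : Holds γ r x σ) (hx : γ.lookup x = some (v, l, q)) :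
    ∃ σ', Exec pop σ (Outcome.ok σ') ∧ Holds (γ.update x (Mark.X, l, r)) x q σ' := by
  obtain ⟨hg, ht, hp⟩ := h
  have h0 := ne_zero_of_lookup hx
  obtain ⟨⟨b0, b1, b2⟩, hu⟩ := hg.block hx
  simp only [pop, Cmd.block]
  refine ⟨_, .seq (.load (n := x + 2) (v := Val.ptr q) ?_ b2)
    (.seq (.write (n := x + 2) (v := Val.ptr r) ?_ ?_)
    (.seq (.write (n := x) (v := Val.mark Mark.X) ?_ rfl)
    (.seq (.assign (v := Val.ptr x) ?_) (.assign (v := Val.ptr q) ?_)))),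
    ⟨hu _ _ ?_ ⟨?_, ?_, ?_⟩, ?_, ?_⟩⟩
  · simp [State.addr, Expr.eval, hp, h0, fieldR, b2]
  · simp [State.addr, Expr.eval, State.set, hp, h0, fieldR, b2]
  · simp [Expr.eval, State.set, ht]
  · simp [State.addr, Expr.eval, State.set, hp, h0, fieldM, b0, lookup_update]
  · simp [Expr.eval, State.set, hp]
  · simp [Expr.eval, State.set]
  · intro y hy
    have h1 : y ≠ x := by omega
    have h2 : y ≠ x + 2 := by omega
    simp [State.set, lookup_update, h1, h2]
  · simp [State.set, lookup_update, b0]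
  · simp [State.set, lookup_update, b1]
  · simp [State.set, lookup_update, b2]
  · simp [State.set]
  · simp [State.set]

/-- The main loop, started in `σ`, reaches the loop head again in the state `σ'`. -/
def LoopReaches (σ σ' : State) : Prop := ∀ o, Exec swLoop σ' o → Exec swLoop σ o

theorem LoopReaches.trans {σ₁ σ₂ σ₃ : State} (h : LoopReaches σ₁ σ₂) (h' : LoopReaches σ₂ σ₃) :
    LoopReaches σ₁ σ₃ := fun o ho => h o (h' o ho)

/-- One loop iteration. The mark `O` of `x` makes `tm` false, which selects the push branch. -/
theorem loopReaches_push {γ : BinaryGraph Mark} {x q l r : ℕ} {σ : State}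
    (h : AtHead γ x q σ) (hx : γ.lookup x = some (Mark.O, l, r)) (hl : l ∈ nodes₀ γ) :
    ∃ σ', LoopReaches σ σ' ∧ AtHead (γ.update x (Mark.L, q, r)) l x σ' := by
  obtain ⟨σ₁, e₁, h₁⟩ := exec_push h.toHolds hx
  obtain ⟨σ₂, e₂, h₂⟩ := exec_readMark h₁ (by rwa [nodes₀_update])
  have htm := h.tm_false (mem_nodes_filterVal.2 ⟨_, hx, rfl⟩)
  refine ⟨σ₂, fun o ho => .loop_true ?_ (.seq (.seq (.ite_false ?_ e₁) e₂) ho), h₂⟩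
  · simp [Expr.eval, Expr.null, htm]
  · simp [Expr.eval, htm]

theorem loopReaches_swing {γ : BinaryGraph Mark} {x q l r : ℕ} {σ : State}
    (h : AtHead γ l x σ) (hx : γ.lookup x = some (Mark.L, q, r))
    (hl : l ∉ nodes (unmarked γ)) (hr : r ∈ nodes₀ γ) :
    ∃ σ', LoopReaches σ σ' ∧ AtHead (γ.update x (Mark.R, l, q)) r x σ' := by
  have htm := h.tm_true hl
  have hp := h.p
  have h0 := ne_zero_of_lookup hx
  have hb := (h.graph.block hx).1.mark
  have h' : Holds γ l x (σ.set Var.pm (Val.mark Mark.L)) :=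
    ⟨h.graph, by simp [State.set, h.t], by simp [State.set, h.p]⟩
  obtain ⟨σ₁, e₁, h₁⟩ := exec_swing h' hx
  obtain ⟨σ₂, e₂, h₂⟩ := exec_readMark h₁ (by rwa [nodes₀_update])
  refine ⟨σ₂, fun o ho => .loop_true ?_ (.seq (.seq (.ite_true ?_
    (.seq (.load (n := x) ?_ hb) (.ite_false ?_ e₁))) e₂) ho), h₂⟩
  · simp [Expr.eval, Expr.null, htm, hp, h0]
  · simp [Expr.eval, htm]
  · simp [State.addr, Expr.eval, hp, h0, fieldM, hb]
  · simp [Expr.eval, State.set]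

theorem loopReaches_pop {γ : BinaryGraph Mark} {x q l r : ℕ} {σ : State}
    (h : AtHead γ r x σ) (hx : γ.lookup x = some (Mark.R, l, q))
    (hr : r ∉ nodes (unmarked γ)) :
    ∃ σ', LoopReaches σ σ' ∧ AtHead (γ.update x (Mark.X, l, r)) x q σ' := by
  have htm := h.tm_true hr
  have hp := h.p
  have h0 := ne_zero_of_lookup hx
  have hb := (h.graph.block hx).1.mark
  have h' : Holds γ r x (σ.set Var.pm (Val.mark Mark.R)) :=
    ⟨h.graph, by simp [State.set, h.t], by simp [State.set, h.p]⟩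
  obtain ⟨σ₁, e₁, h₁⟩ := exec_pop h' hx
  obtain ⟨σ₂, e₂, h₂⟩ := exec_readMark h₁ (by
    rw [nodes₀_update]
    exact Or.inr (mem_nodes_iff.2 ⟨_, hx⟩))
  refine ⟨σ₂, fun o ho => .loop_true ?_ (.seq (.seq (.ite_true ?_
    (.seq (.load (n := x) ?_ hb) (.ite_true ?_ e₁))) e₂) ho), h₂⟩
  · simp [Expr.eval, Expr.null, htm, hp, h0]
  · simp [Expr.eval, htm]
  · simp [State.addr, Expr.eval, hp, h0, fieldM, hb]
  · simp [Expr.eval, State.set]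

/-! ### Traversal of everything reachable from `t`. -/

theorem notMem_reach_remove {T : Type*} (γ : BinaryGraph T) (x y : ℕ) :
    x ∉ reach (γ.remove x) y := fun h =>
  reach_subset_nodes _ _ h (by simp [lookup_remove])

/-- An unmarked node reaches itself. So `tm` is true after a traversal, and the next iteration
swings or pops, or the loop ends if `p` is null. -/
theorem notMem_nodes_unmarked_markX_reach (γ : BinaryGraph Mark) (x : ℕ) :
    x ∉ nodes (unmarked (γ.markX (reach (unmarked γ) x))) := by
  classical
  rw [unmarked_markX]
  intro h
  by_cases hx : x ∈ reach (unmarked γ) x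
  · exact h (by simp [lookup_restrict, hx])
  · have hx' : x ∈ nodes (unmarked γ) := fun h0 => h (by simp [lookup_restrict, h0])
    exact hx (mem_reach_iff.2 ⟨hx', .refl⟩)

/-- The effect of a traversal of a node on the graph: push, traversal of the left child, swing,
traversal of the right child, and pop. -/
theorem markX_reach_of_lookup {γ : BinaryGraph Mark} {x q l r : ℕ} {S₁ S₂ : Set ℕ}
    (hx : γ.lookup x = some (Mark.O, l, r)) (h₁ : x ∉ S₁) (h₂ : x ∉ S₂) :
    (markX ((markX (γ.update x (Mark.L, q, r)) S₁).update x (Mark.R, l, q)) S₂).update x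
      (Mark.X, l, r) = γ.markX ({x} ∪ (S₁ ∪ S₂)) := by
  ext1
  funext y
  by_cases hy : y = x
  · subst hy
    have e : (γ.markX ({y} ∪ (S₁ ∪ S₂))).lookup y = some (Mark.X, l, r) := by
      rw [lookup_markX_of_mem (by simp), hx]
      rfl
    rw [e]
    simp [lookup_update, lookup_markX_of_notMem h₁, lookup_markX_of_notMem h₂, hx]
  · by_cases hy1 : y ∈ S₁ <;> by_cases hy2 : y ∈ S₂ <;>
      simp [lookup_update, markX, hy, hy1, hy2, Function.comp_def]

/-- Closedness is demanded of unmarked nodes only, since `L` and `R` nodes hold reversed pointers;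
it persists because `nodes₀` is constant and the unmarked graph shrinks. The parent `q` is
arbitrary, which lets the induction hypothesis apply below `x`. -/
theorem loopReaches_traverse {γ : BinaryGraph Mark} {x q : ℕ} {σ : State}
    (hc : sinks (unmarked γ) ⊆ nodes₀ γ) (h : AtHead γ x q σ) :
    ∃ σ', LoopReaches σ σ' ∧ AtHead (γ.markX (reach (unmarked γ) x)) x q σ' := by
  classical
  induction hn : (PMap.dom (unmarked γ)).ncard using Nat.strong_induction_on
    generalizing γ x q σ with
  | _ n ih =>
  cases hux : (unmarked γ).lookup x with
  | none =>
    rw [reach_of_none hux, markX_empty]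
    exact ⟨σ, fun _ => id, h⟩
  | some a =>
    obtain ⟨v, l, r⟩ := a
    obtain ⟨hx, hv⟩ := lookup_filterVal.1 hux
    obtain rfl : v = Mark.O := hv
    have hlt := PMap.ncard_dom_remove_lt _ hux
    rw [hn] at hlt
    have hl : l ∈ nodes₀ γ := hc ⟨x, _, l, r, hux, Or.inl rfl⟩
    have hr : r ∈ nodes₀ γ := hc ⟨x, _, l, r, hux, Or.inr rfl⟩
    have hsub : ∀ δ : BinaryGraph Mark,
        (∀ z a, δ.lookup z = some a → (unmarked γ).lookup z = some a) →
          sinks δ ⊆ nodes₀ γ := by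
      rintro δ hδ y ⟨z, v, l, r, hz, hy⟩
      exact hc ⟨z, v, l, r, hδ _ _ hz, hy⟩
    have hu₁ : unmarked (γ.update x (Mark.L, q, r)) = (unmarked γ).remove x :=
      unmarked_update (by simp)
    have hm₁ : ∀ z a, ((unmarked γ).remove x).lookup z = some a →
        (unmarked γ).lookup z = some a := by
      intro z a hz
      rw [lookup_remove] at hz
      split_ifs at hz
      exact hz
    obtain ⟨σ₁, s₁, h₁⟩ := loopReaches_push h hx hl
    obtain ⟨σ₂, s₂, h₂⟩ := ih _ (by rwa [hu₁]) (by
      rw [hu₁, nodes₀_update]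
      exact hsub _ hm₁) h₁ rfl
    have hl₂ := notMem_nodes_unmarked_markX_reach (γ.update x (Mark.L, q, r)) l
    rw [hu₁] at h₂ hl₂
    have hx₁ : x ∉ reach ((unmarked γ).remove x) l := notMem_reach_remove _ _ _
    -- The left traversal cannot reach `x`, so the fields written by push, among them the parent
    -- pointer, are still intact.
    have hγ₂ : (markX (γ.update x (Mark.L, q, r)) (reach ((unmarked γ).remove x) l)).lookup x =
        some (Mark.L, q, r) := by
      rw [lookup_markX_of_notMem hx₁, lookup_update_self _ hx]
    obtain ⟨σ₃, s₃, h₃⟩ := loopReaches_swing h₂ hγ₂ hl₂ (by rwa [nodes₀_markX, nodes₀_update])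
    -- Swing does not change the unmarked graph: `x` was removed by push already, so removing it
    -- again has no effect.
    have hu₃ : unmarked ((markX (γ.update x (Mark.L, q, r))
        (reach ((unmarked γ).remove x) l)).update x (Mark.R, l, q)) =
        ((unmarked γ).remove x).restrict (reach ((unmarked γ).remove x) l)ᶜ := by
      rw [unmarked_update (by simp), unmarked_markX, hu₁]
      ext1
      funext y
      by_cases hy : y = x <;> simp [lookup_remove, lookup_restrict, hy]
    have hm₃ : ∀ z a, (((unmarked γ).remove x).restrict
        (reach ((unmarked γ).remove x) l)ᶜ).lookup z = some a →
          ((unmarked γ).remove x).lookup z = some a := by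
      intro z a hz
      rw [lookup_restrict] at hz
      split_ifs at hz
      exact hz
    obtain ⟨σ₄, s₄, h₄⟩ := ih _ (by
      rw [hu₃]
      refine lt_of_le_of_lt (Set.ncard_le_ncard (t := PMap.dom _) ?_ (PMap.finite_dom _)) hlt
      intro z hz
      obtain ⟨a, ha⟩ := Option.ne_none_iff_exists'.1 hz
      rw [mem_dom_iff, hm₃ z a ha]
      simp) (by
      rw [hu₃, nodes₀_update, nodes₀_markX, nodes₀_update]
      exact hsub _ fun z a hz => hm₁ z a (hm₃ z a hz)) h₃ rfl
    have hr₄ := notMem_nodes_unmarked_markX_reach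
      ((markX (γ.update x (Mark.L, q, r)) (reach ((unmarked γ).remove x) l)).update x
        (Mark.R, l, q)) r
    rw [hu₃] at h₄ hr₄
    have hx₃ : x ∉ reach (((unmarked γ).remove x).restrict
        (reach ((unmarked γ).remove x) l)ᶜ) r := fun hxr =>
      reach_subset_nodes _ _ hxr (by simp [lookup_restrict, lookup_remove])
    obtain ⟨σ₅, s₅, h₅⟩ := loopReaches_pop h₄
      (by rw [lookup_markX_of_notMem hx₃, lookup_update_self _ hγ₂]) hr₄
    rw [markX_reach_of_lookup hx hx₁ hx₃, reach_union_reach_restrict, ← reach_of_some hux] at h₅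
    exact ⟨σ₅, s₁.trans (s₂.trans (s₃.trans (s₄.trans s₅))), h₅⟩

theorem exec_schorrWaite {γ : BinaryGraph Mark} {r : ℕ} {σ : State} (hg : graph γ σ.heap)
    (hc : sinks (unmarked γ) ⊆ nodes₀ γ) (hr : r ∈ nodes γ) :
    ∃ σ', Exec (schorrWaite r) σ (Outcome.ok σ') ∧
      graph (γ.markX (reach (unmarked γ) r)) σ'.heap := by
  -- The root has null as its parent. The traversal returns with `p` null again and `tm` true, which
  -- is the exit condition of the loop.
  obtain ⟨σ₁, e₁, h₁⟩ := exec_readMark (γ := γ) (x := r) (q := 0)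
    (σ := (σ.set Var.t (Val.ptr r)).set Var.p (Val.ptr 0))
    ⟨hg, by simp [State.set], by simp [State.set]⟩ (Or.inr hr)
  obtain ⟨σ₂, s₂, h₂⟩ := loopReaches_traverse hc h₁
  have htm := h₂.tm_true (notMem_nodes_unmarked_markX_reach γ r)
  refine ⟨σ₂, .seq (.assign rfl) (.seq (.assign rfl) (.seq e₁ (s₂ _ (.loop_false ?_)))),
    h₂.graph⟩
  simp [Expr.eval, Expr.null, htm, h₂.p]

/-! ### The postcondition for the marked graph. -/

theorem erasure_markX (γ : BinaryGraph Mark) (S : Set ℕ) : erasure (γ.markX S) = erasure γ := by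
  ext1
  funext y
  by_cases hy : y ∈ S <;> simp [erasure, lookup_map, markX, hy, Function.comp_def]

theorem join_filterVal {T : Type*} {γ : BinaryGraph T} {u v : T} (huv : u ≠ v)
    (h : ∀ y a, γ.lookup y = some a → a.1 = u ∨ a.1 = v) :
    PMap.join (γ.filterVal {u}) (γ.filterVal {v}) = some γ := by
  classical
  have key : ∀ w y, (γ.filterVal {w}).lookup y =
      if ∃ a, γ.lookup y = some a ∧ a.1 = w then γ.lookup y else none := by
    intro w y
    refine Option.ext fun b => ?_
    rw [lookup_filterVal]
    split_ifs with hw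
    · obtain ⟨a, ha, rfl⟩ := hw
      simp only [ha, Option.some.injEq, Set.mem_singleton_iff, and_iff_left_iff_imp]
      rintro rfl
      rfl
    · simp only [Set.mem_singleton_iff, iff_false]
      exact fun hb => hw ⟨b, hb⟩
  rw [join_eq_some_iff]
  refine ⟨fun y => ?_, fun y => ?_⟩
  · rw [key, key]
    cases hy : γ.lookup y with
    | none => simp
    | some a =>
      by_cases hau : a.1 = u
      · right
        simp [hau, huv]
      · left
        simp [hau]
  · rw [key, key]
    cases hy : γ.lookup y with
    | none => simp
    | some a => rcases h y a hy with rfl | rfl <;> simp [huv.symm]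

theorem swPost_of_graph {γ₀ : BinaryGraph Mark} {r : ℕ} {σ : State}
    (hO : γ₀ = unmarked γ₀) (hg : graph (γ₀.markX (reach (unmarked γ₀) r)) σ.heap) :
    swPost γ₀ r σ := by
  have hm : ∀ y a, γ₀.lookup y = some a → a.1 = Mark.O := by
    intro y a ha
    rw [hO] at ha
    exact (lookup_filterVal.1 ha).2
  refine ⟨_, hg, (erasure_markX _ _).symm, join_filterVal (by simp) ?_, ?_⟩
  · intro y a ha
    by_cases hy : y ∈ reach (unmarked γ₀) r
    · rw [lookup_markX_of_mem hy, Option.map_eq_some_iff] at ha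
      obtain ⟨b, -, rfl⟩ := ha
      exact Or.inl rfl
    · rw [lookup_markX_of_notMem hy] at ha
      exact Or.inr (hm y a ha)
  · ext y
    rw [mem_nodes_filterVal]
    by_cases hy : y ∈ reach (unmarked γ₀) r
    · obtain ⟨b, hb⟩ := mem_nodes_iff.1 (reach_subset_nodes _ _ hy)
      simp [lookup_markX_of_mem hy, (lookup_filterVal.1 hb).1, hy]
    · simp only [lookup_markX_of_notMem hy, hy, iff_false]
      rintro ⟨a, ha, hX⟩
      rw [Set.mem_singleton_iff, hm y a ha] at hX
      cases hX

end GraphMarking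

theorem mainTheorem1 (γ₀ : GraphMarking.BinaryGraph GraphMarking.Mark) (r : ℕ) :
    GraphMarking.Triple (GraphMarking.swPre γ₀ r) (GraphMarking.schorrWaite r)
        (GraphMarking.swPost γ₀ r) ∧
      GraphMarking.Terminates (GraphMarking.swPre γ₀ r) (GraphMarking.schorrWaite r) := by
  refine GraphMarking.triple_and_terminates ?_
  rintro σ ⟨hg, hc, hr, hO⟩
  obtain ⟨σ', he, hg'⟩ := GraphMarking.exec_schorrWaite hg (by
    rw [GraphMarking.BinaryGraph.unmarked, ← hO]
    exact hc) hr
  exact ⟨σ', he, GraphMarking.swPost_of_graph hO hg'⟩
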